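/- Let $F_1,\dots,F_n$ be non-abelian free groups of finite rank with fixed bases $S_1,\dots,S_n$, and let $*F = F_1*\cdots*F_n$ be their free product. For each $i$ let $\Delta_i$ be a decomposition of $F_i$, let $\varphi_i : F_i\to\mathbb{R}$ be a $\Delta_i$-decomposable quasimorphism and $\psi_i : F_i\to\mathbb{R}$ a $\Delta_i$-continuous quasimorphism. Then $\varphi = \varphi_1*\cdots*\varphi_n$ and $\psi = \psi_1*\cdots*\psi_n$ are quasimorphisms of $*F$, and $$[\delta^1\varphi]\smile[\delta^1\psi] = 0 \in H^4_b(*F).$$ The notions used are the following. *Bounded cohomology.* $H^\bullet_b(G)$ is the bounded cohomology of the discrete group $G$ with trivial real coefficients, computed by bounded functions $G^k\to\mathbb{R}$ in the bar resolution, with cup product induced by $(f\smile f')(g_1,\dots,g_{k+m}) = f(g_1,\dots,g_k)\,f'(g_{k+1},\dots,g_{k+m})$. A map $\varphi:G\to\mathbb{R}$ is a quasimorphism if $\delta^1\varphi(g,h)=\varphi(g)+\varphi(h)-\varphi(gh)$ is bounded on $G^2$, and alternating if $\varphi(g^{-1})=-\varphi(g)$ for all $g$. *Decompositions.* For a finite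 sequence $x=(x_1,\dots,x_k)$ in a group put $x^{-1}=(x_k^{-1},\dots,x_1^{-1})$, and write $\cdot$ for concatenation of sequences. A decomposition of a free group $F$ with basis $S$ consists of a symmetric set $\mathcal{P}\subset F\setminus\{1\}$ of pieces and a map $\Delta$ assigning to each $g\in F$ a finite sequence $\Delta(g)=(g_1,\dots,g_k)$ in $\mathcal{P}$, with $\Delta(1)$ empty, such that: (1) $g=g_1\cdots g_k$ as a reduced product (no cancellation in the basis $S$); (2) $\Delta(g^{-1})=\Delta(g)^{-1}$; (3) $\Delta(g_i\cdots g_j)=(g_i,\dots,g_j)$ for $1\le i\le j\le k$; (4) there is $D\ge 0$ such that for all $g,h\in F$ the sequences $r_1,r_2,r_3$ defined as follows have length at most $D$. Let $c_1^{-1}$ be the largest common initial segment of $\Delta(g)$ and $\Delta(gh)$, let $c_2$ be the largest common final segment of $\Delta(g)$ and $\Delta(h^{-1})$, and let $c_3$ be the largest common final segment of $\Delta(h)$ and $\Delta(gh)$; then $\Delta(g)=c_1^{-1}\cdot r_1\cdot c_2$, $\Delta(h)=c_2^{-1}\cdot r_2\cdot c_3$ and $\Delta(gh)=c_1^{-1}\cdot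 r_3^{-1}\cdot c_3$. *Decomposable quasimorphisms.* $\varphi$ is $\Delta$-decomposable if there is a bounded $\lambda:\mathcal{P}\to\mathbb{R}$ with $\lambda(p^{-1})=-\lambda(p)$ and $\varphi(g)=\sum_{j=1}^k\lambda(g_j)$ whenever $\Delta(g)=(g_1,\dots,g_k)$. *Continuous quasimorphisms.* For pairs $(g,h),(g',h')\in F^2$ with associated sequences $c_i,r_i$ and $c_i',r_i'$, put $N_\Delta((g,h),(g',h'))=0$ if $r_i\ne r_i'$ for some $i$, and otherwise $N_\Delta((g,h),(g',h'))=\min(N_1,N_2,N_3)$, where $N_i=\infty$ if $c_i=c_i'$ and otherwise $N_i$ is the length of the largest common initial segment of $c_i$ and $c_i'$. An alternating quasimorphism $\psi$ is $\Delta$-continuous if there is a non-negative summable sequence $(x_j)_{j\ge0}$ with $|\delta^1\psi(g,h)-\delta^1\psi(g',h')|\le x_N$, $N=N_\Delta((g,h),(g',h'))$, for all $(g,h)\ne(g',h')$ in $F^2$. *Free products.* Every $1\ne g\in *F$ can be written uniquely as $g=g_1\cdots g_k$ with $1\ne g_j\in F_{i_j}$ and $i_j\ne i_{j+1}$; then $(\varphi_1*\cdots*\varphi_n)(g)=\sum_{j=1}^k\varphi_{i_j}(g_j)$,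 and the value at $1$ is $0$. -/

import Mathlib

/-! ## Bounded cohomology of a discrete group with trivial real coefficients (bar resolution) -/

section BoundedCohomology

variable {G : Type*} [Group G]

/-- The coboundary of the bar resolution,
`(δ f)(g₁,…,gₙ₊₁) = f(g₂,…,gₙ₊₁) + ∑_{1 ≤ i ≤ n} (-1)ⁱ f(g₁,…,gᵢgᵢ₊₁,…,gₙ₊₁)
  + (-1)ⁿ⁺¹ f(g₁,…,gₙ)`.
`Fin.contractNth j` multiplies two neighbouring entries, and drops the last entry if `j` is the
last index. -/
def barδ (G : Type*) [Group G] (n : ℕ) :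
    ((Fin n → G) → ℝ) →ₗ[ℝ] ((Fin (n + 1) → G) → ℝ) where
  toFun f g := f (fun i => g i.succ) +
    ∑ j : Fin (n + 1), (-1 : ℝ) ^ ((j : ℕ) + 1) * f (Fin.contractNth j (· * ·) g)
  map_add' f f' := by
    funext g
    simp only [Pi.add_apply, mul_add, Finset.sum_add_distrib]
    ring
  map_smul' c f := by
    funext g
    simp only [Pi.smul_apply, smul_eq_mul, RingHom.id_apply, mul_add, Finset.mul_sum]
    congr 1
    exact Finset.sum_congr rfl fun j _ => by ring

/-- The space `Cⁿ_b(G)` of bounded cochains. -/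
def boundedCochains (G : Type*) (n : ℕ) : Submodule ℝ ((Fin n → G) → ℝ) where
  carrier := {f | ∃ C : ℝ, ∀ g, |f g| ≤ C}
  zero_mem' := ⟨0, fun g => by simp⟩
  add_mem' := by
    rintro f f' ⟨C, hC⟩ ⟨C', hC'⟩
    exact ⟨C + C', fun g => (abs_add_le _ _).trans (add_le_add (hC g) (hC' g))⟩
  smul_mem' := by
    rintro c f ⟨C, hC⟩
    refine ⟨|c| * C, fun g => ?_⟩
    simp only [Pi.smul_apply, smul_eq_mul, abs_mul]
    exact mul_le_mul_of_nonneg_left (hC g) (abs_nonneg c)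

/-- The space `Zⁿ_b(G)` of bounded cocycles. -/
def boundedCocycles (G : Type*) [Group G] (n : ℕ) : Submodule ℝ ((Fin n → G) → ℝ) :=
  boundedCochains G n ⊓ LinearMap.ker (barδ G n)

/-- The space `Bⁿ_b(G)` of coboundaries of bounded cochains. -/
def boundedCoboundaries (G : Type*) [Group G] : (n : ℕ) → Submodule ℝ ((Fin n → G) → ℝ)
  | 0 => ⊥
  | n + 1 => (boundedCochains G n).map (barδ G n)

/-- Bounded cohomology `Hⁿ_b(G) = Zⁿ_b(G) / Bⁿ_b(G)`. -/
abbrev BoundedCohomology (G : Type*) [Group G] (n : ℕ) : Type _ :=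
  boundedCocycles G n ⧸ (boundedCoboundaries G n).submoduleOf (boundedCocycles G n)

/-- The cup product of cochains,
`(f ⌣ f')(g₁,…,gₙ₊ₘ) = f(g₁,…,gₙ) f'(gₙ₊₁,…,gₙ₊ₘ)`. -/
def cochainCup {G : Type*} {n m k : ℕ} (h : n + m = k) :
    ((Fin n → G) → ℝ) →ₗ[ℝ] ((Fin m → G) → ℝ) →ₗ[ℝ] ((Fin k → G) → ℝ) :=
  LinearMap.mk₂ ℝ
    (fun f f' g => f (fun i => g ⟨i, by omega⟩) * f' (fun i => g ⟨n + i, by omega⟩))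
    (fun _ _ _ => funext fun _ => add_mul _ _ _)
    (fun _ _ _ => funext fun _ => mul_assoc _ _ _)
    (fun _ _ _ => funext fun _ => mul_add _ _ _)
    (fun _ _ _ => funext fun _ => mul_left_comm _ _ _)

theorem cochainCup_apply {G : Type*} {n m k : ℕ} (h : n + m = k) (f : (Fin n → G) → ℝ)
    (f' : (Fin m → G) → ℝ) (g : Fin k → G) :
    cochainCup h f f' g =
      f (fun i => g ⟨i, by omega⟩) * f' (fun i => g ⟨n + i, by omega⟩) := rfl

/-- The Leibniz rule. -/
theorem barδ_cochainCup {n m k : ℕ} (h : n + m = k) (f : (Fin n → G) → ℝ)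
    (f' : (Fin m → G) → ℝ) :
    barδ G k (cochainCup h f f') =
      cochainCup (show n + 1 + m = k + 1 by omega) (barδ G n f) f' +
        (-1 : ℝ) ^ n • cochainCup (show n + (m + 1) = k + 1 by omega) f (barδ G m f') := by
  subst h
  funext g
  simp only [Pi.add_apply, Pi.smul_apply, smul_eq_mul, cochainCup_apply, barδ,
    LinearMap.coe_mk, AddHom.coe_mk]
  have e := Fin.sum_univ_add (a := n) (b := m + 1) fun j : Fin (n + (m + 1)) =>
    (-1 : ℝ) ^ ((j : ℕ) + 1) *
      (f (fun i => Fin.contractNth (n := n + m) j (· * ·) g ⟨i, by omega⟩) *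
        f' (fun i => Fin.contractNth (n := n + m) j (· * ·) g ⟨n + i, by omega⟩))
  refine (congrArg₂ (· + ·) rfl e).trans ?_
  rw [Fin.sum_univ_castSucc (n := n)]
  have h1 : ∀ j : Fin n,
      (f (fun i => Fin.contractNth (n := n + m) (Fin.castAdd (m + 1) j) (· * ·) g ⟨i, by omega⟩) *
        f' (fun i =>
          Fin.contractNth (n := n + m) (Fin.castAdd (m + 1) j) (· * ·) g ⟨n + i, by omega⟩)) =
      f (Fin.contractNth j.castSucc (· * ·) fun i => g ⟨i, by omega⟩) *
        f' (fun i => g ⟨n + 1 + i, by omega⟩) := by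
    intro j
    congr 2
    funext i
    have hj := j.2
    simp only [Fin.contractNth, Fin.val_castAdd, Fin.succ_mk]
    rw [if_neg (by omega), if_neg (by omega)]
    congr 2
    omega
  have h2 : ∀ j : Fin (m + 1),
      (f (fun i => Fin.contractNth (n := n + m) (Fin.natAdd n j) (· * ·) g ⟨i, by omega⟩) *
        f' (fun i =>
          Fin.contractNth (n := n + m) (Fin.natAdd n j) (· * ·) g ⟨n + i, by omega⟩)) =
      f (fun i => g ⟨i, by omega⟩) *
        f' (Fin.contractNth j (· * ·) fun i => g ⟨n + i, by omega⟩) := by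
    intro j
    congr 2
    · funext i
      have hi := i.2
      simp only [Fin.contractNth, Fin.val_natAdd, Fin.castSucc_mk]
      rw [if_pos (by omega)]
    · funext i
      simp only [Fin.contractNth, Fin.val_natAdd, Fin.castSucc_mk, Fin.succ_mk, Fin.val_castSucc,
        Fin.val_succ, add_lt_add_iff_left, add_right_inj, add_assoc]
  have h3 : (Fin.contractNth (Fin.last n) (· * ·) fun i : Fin (n + 1) => g ⟨i, by omega⟩) =
      fun i : Fin n => g ⟨i, by omega⟩ := by
    funext i
    simp [Fin.contractNth]
  simp only [h1, h2, h3, Fin.val_castAdd, Fin.val_natAdd, Fin.val_castSucc, Fin.val_last,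
    Fin.succ_mk, Fin.val_succ]
  have h4 : (fun i : Fin m => g ⟨n + 1 + i, by omega⟩) =
      fun i : Fin m => g ⟨n + (i + 1), by omega⟩ := by
    funext i
    congr 2
    omega
  have h5 : (fun i : Fin m => g ⟨n + i + 1, by omega⟩) =
      fun i : Fin m => g ⟨n + (i + 1), by omega⟩ := rfl
  rw [h4, h5]
  simp only [add_mul, mul_add, Finset.sum_mul, Finset.mul_sum, pow_succ, pow_add]
  have h6 : ∀ x : ℝ, ∀ y : Fin (m + 1) → ℝ,
      ∑ j : Fin (m + 1), (-1 : ℝ) ^ n * (-1) ^ (j : ℕ) * -1 * (x * y j) =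
        ∑ j : Fin (m + 1), (-1 : ℝ) ^ n * (x * ((-1) ^ (j : ℕ) * -1 * y j)) :=
    fun x y => Finset.sum_congr rfl fun j _ => by ring
  rw [h6]
  have h7 : ∀ x : ℝ, ∀ y : Fin n → ℝ,
      ∑ j : Fin n, (-1 : ℝ) ^ (j : ℕ) * -1 * (y j * x) =
        ∑ j : Fin n, (-1 : ℝ) ^ (j : ℕ) * -1 * y j * x :=
    fun x y => Finset.sum_congr rfl fun j _ => by ring
  rw [h7]
  ring

theorem cochainCup_mem_boundedCochains {G : Type*} {n m k : ℕ} (h : n + m = k) {f : (Fin n → G) → ℝ}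
    {f' : (Fin m → G) → ℝ} (hf : f ∈ boundedCochains G n) (hf' : f' ∈ boundedCochains G m) :
    cochainCup h f f' ∈ boundedCochains G k := by
  obtain ⟨C, hC⟩ := hf
  obtain ⟨C', hC'⟩ := hf'
  refine ⟨|C| * |C'|, fun g => ?_⟩
  rw [cochainCup_apply, abs_mul]
  exact mul_le_mul ((hC _).trans (le_abs_self C)) ((hC' _).trans (le_abs_self C'))
    (abs_nonneg _) (abs_nonneg _)

theorem cochainCup_mem_boundedCocycles {n m k : ℕ} (h : n + m = k) {f : (Fin n → G) → ℝ}
    {f' : (Fin m → G) → ℝ} (hf : f ∈ boundedCocycles G n) (hf' : f' ∈ boundedCocycles G m) :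
    cochainCup h f f' ∈ boundedCocycles G k := by
  refine ⟨cochainCup_mem_boundedCochains h hf.1 hf'.1, ?_⟩
  rw [SetLike.mem_coe, LinearMap.mem_ker, barδ_cochainCup, LinearMap.mem_ker.1 hf.2,
    LinearMap.mem_ker.1 hf'.2]
  simp

theorem cochainCup_coboundary_left {n m k : ℕ} (h : n + m = k) {f : (Fin n → G) → ℝ}
    {f' : (Fin m → G) → ℝ} (hf : f ∈ boundedCoboundaries G n) (hf' : f' ∈ boundedCocycles G m) :
    cochainCup h f f' ∈ boundedCoboundaries G k := by
  cases n with
  | zero =>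
    rw [boundedCoboundaries, Submodule.mem_bot] at hf
    rw [hf, map_zero, LinearMap.zero_apply]
    exact zero_mem _
  | succ n =>
    obtain ⟨p, hp, rfl⟩ := hf
    obtain ⟨k, rfl⟩ : ∃ k', k = k' + 1 := ⟨n + m, by omega⟩
    refine ⟨cochainCup (show n + m = k by omega) p f',
      cochainCup_mem_boundedCochains _ hp hf'.1, ?_⟩
    rw [barδ_cochainCup, LinearMap.mem_ker.1 hf'.2]
    simp

theorem cochainCup_coboundary_right {n m k : ℕ} (h : n + m = k) {f : (Fin n → G) → ℝ}
    {f' : (Fin m → G) → ℝ} (hf : f ∈ boundedCocycles G n) (hf' : f' ∈ boundedCoboundaries G m) :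
    cochainCup h f f' ∈ boundedCoboundaries G k := by
  cases m with
  | zero =>
    rw [boundedCoboundaries, Submodule.mem_bot] at hf'
    rw [hf', map_zero]
    exact zero_mem _
  | succ m =>
    obtain ⟨p, hp, rfl⟩ := hf'
    obtain ⟨k, rfl⟩ : ∃ k', k = k' + 1 := ⟨n + m, by omega⟩
    refine ⟨(-1 : ℝ) ^ n • cochainCup (show n + m = k by omega) f p,
      Submodule.smul_mem _ _ (cochainCup_mem_boundedCochains _ hf.1 hp), ?_⟩
    rw [map_smul, barδ_cochainCup, LinearMap.mem_ker.1 hf.2, map_zero, LinearMap.zero_apply,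
      zero_add, smul_smul, ← mul_pow]
    simp

/-- The cup product of bounded cocycles. -/
def cocycleCup {n m k : ℕ} (h : n + m = k) :
    boundedCocycles G n →ₗ[ℝ] boundedCocycles G m →ₗ[ℝ] boundedCocycles G k :=
  LinearMap.mk₂ ℝ
    (fun f f' => ⟨cochainCup h f.1 f'.1, cochainCup_mem_boundedCocycles h f.2 f'.2⟩)
    (fun _ _ _ => Subtype.ext (by simp))
    (fun _ _ _ => Subtype.ext (by simp))
    (fun _ _ _ => Subtype.ext (by simp))
    (fun _ _ _ => Subtype.ext (by simp))

/-- The class `[f] ∈ Hⁿ_b(G)` of a bounded cocycle. -/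
def cocycleClass (n : ℕ) : boundedCocycles G n →ₗ[ℝ] BoundedCohomology G n :=
  Submodule.mkQ _

/-- The cup product `⌣ : Hⁿ_b(G) × Hᵐ_b(G) → Hⁿ⁺ᵐ_b(G)`, `[f] ⌣ [f'] = [f ⌣ f']`. -/
def cupProduct {n m k : ℕ} (h : n + m = k) :
    BoundedCohomology G n →ₗ[ℝ] BoundedCohomology G m →ₗ[ℝ] BoundedCohomology G k :=
  (Submodule.liftQ _
    (Submodule.liftQ _ ((cocycleCup h).compr₂ (cocycleClass k)) (by
      intro f hf
      rw [LinearMap.mem_ker]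
      ext f'
      exact (Submodule.Quotient.mk_eq_zero _).2 (cochainCup_coboundary_left h hf f'.2))).flip (by
    intro f' hf'
    rw [LinearMap.mem_ker]
    refine LinearMap.ext fun x => ?_
    obtain ⟨f, rfl⟩ := Submodule.mkQ_surjective _ x
    exact (Submodule.Quotient.mk_eq_zero _).2 (cochainCup_coboundary_right h f.2 hf'))).flip

theorem cupProduct_cocycleClass {n m k : ℕ} (h : n + m = k) (f : boundedCocycles G n)
    (f' : boundedCocycles G m) :
    cupProduct h (cocycleClass n f) (cocycleClass m f') = cocycleClass k (cocycleCup h f f') :=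
  rfl

/-! ### Quasimorphisms -/

/-- `φ : G → ℝ` is a quasimorphism if its defect `sup |φ(g) + φ(h) - φ(gh)|` is finite. -/
def IsQuasimorphism (φ : G → ℝ) : Prop :=
  ∃ C : ℝ, ∀ g h : G, |φ g + φ h - φ (g * h)| ≤ C

/-- `φ : G → ℝ` is alternating if `φ(g⁻¹) = -φ(g)` for all `g`. -/
def IsAlternating (φ : G → ℝ) : Prop :=
  ∀ g : G, φ g⁻¹ = -φ g

/-- A function `φ : G → ℝ`, seen as a 1-cochain. -/
def toCochain (φ : G → ℝ) : (Fin 1 → G) → ℝ := fun g => φ (g 0)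

theorem barδ_toCochain (φ : G → ℝ) (g : Fin 2 → G) :
    barδ G 1 (toCochain φ) g = φ (g 0) + φ (g 1) - φ (g 0 * g 1) := by
  simp [barδ, toCochain, Fin.sum_univ_two, Fin.contractNth]
  ring

theorem barδ_toCochain_mem {φ : G → ℝ} (hφ : IsQuasimorphism φ) :
    barδ G 1 (toCochain φ) ∈ boundedCocycles G 2 := by
  constructor
  · obtain ⟨C, hC⟩ := hφ
    exact ⟨C, fun g => by rw [barδ_toCochain]; exact hC _ _⟩
  · rw [SetLike.mem_coe, LinearMap.mem_ker]
    funext g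
    have h := barδ_toCochain φ
    generalize barδ G 1 (toCochain φ) = ω at h ⊢
    simp [barδ, Fin.sum_univ_three, h, Fin.contractNth, mul_assoc]
    ring

/-- The class `[δ¹φ] ∈ H²_b(G)` of a quasimorphism `φ`. -/
def coboundaryClass (φ : G → ℝ) (hφ : IsQuasimorphism φ) : BoundedCohomology G 2 :=
  cocycleClass 2 ⟨barδ G 1 (toCochain φ), barδ_toCochain_mem hφ⟩

end BoundedCohomology

/-! ## Triangles of sequences -/

section Triangles

variable {G : Type*} [Group G] [DecidableEq G]

/-- The inverse `(x₁,…,xₖ)⁻¹ = (xₖ⁻¹,…,x₁⁻¹)` of a finite sequence. -/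
def seqInv (l : List G) : List G := (l.map (·⁻¹)).reverse

/-- The largest common initial segment of two sequences. -/
def commonPrefix : List G → List G → List G
  | a :: l, b :: m => if a = b then a :: commonPrefix l m else []
  | _, _ => []

/-- The largest common final segment of two sequences. -/
def commonSuffix (l m : List G) : List G := (commonPrefix l.reverse m.reverse).reverse

/-- `l` without its first `a` and its last `b` entries. -/
def middle (l : List G) (a b : ℕ) : List G := (l.drop a).take (l.length - a - b)

/-- The `c`-part `(c₁, c₂, c₃)` of the `Δ`-triangle for `g, h`: `c₁⁻¹` is the largest common initial
segment of `Δ(g)` and `Δ(gh)`, `c₂` the largest common final segment of `Δ(g)` and `Δ(h⁻¹)`, and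
`c₃` the largest common final segment of `Δ(h)` and `Δ(gh)`. Each `cᵢ` starts at the centre. -/
def cPart (Δ : G → List G) (g h : G) : Fin 3 → List G :=
  ![seqInv (commonPrefix (Δ g) (Δ (g * h))),
    commonSuffix (Δ g) (Δ h⁻¹),
    commonSuffix (Δ h) (Δ (g * h))]

/-- The `r`-part `(r₁, r₂, r₃)` of the `Δ`-triangle for `g, h`: what remains in
`Δ(g) = c₁⁻¹ · r₁ · c₂`, `Δ(h) = c₂⁻¹ · r₂ · c₃` and `Δ(gh) = c₁⁻¹ · r₃⁻¹ · c₃`. -/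
def rPart (Δ : G → List G) (g h : G) : Fin 3 → List G :=
  ![middle (Δ g) (cPart Δ g h 0).length (cPart Δ g h 1).length,
    middle (Δ h) (cPart Δ g h 1).length (cPart Δ g h 2).length,
    seqInv (middle (Δ (g * h)) (cPart Δ g h 0).length (cPart Δ g h 2).length)]

/-- The number of steps two sequences travel together before they split (`∞` if equal). -/
def stepsTogether (c c' : List G) : ℕ∞ :=
  if c = c' then ⊤ else ((commonPrefix c c').length : ℕ∞)

/-- The function `N_Δ((g, h), (g', h'))`: zero if the two `Δ`-triangles have different `r`-parts,
and otherwise the least number of steps that `cᵢ` and `cᵢ'` travel together, `i = 1, 2, 3`. -/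
noncomputable def triangleOverlap (Δ : G → List G) (p p' : G × G) : ℕ∞ :=
  if rPart Δ p.1 p.2 = rPart Δ p'.1 p'.2 then
    ⨅ i : Fin 3, stepsTogether (cPart Δ p.1 p.2 i) (cPart Δ p'.1 p'.2 i)
  else 0

end Triangles

/-! ## Decompositions of a free group -/

/-- A decomposition of the free group with basis `S`. -/
structure Decomposition (S : Type*) [DecidableEq S] where
  /-- the set of pieces -/
  pieces : Set (FreeGroup S)
  inv_mem_pieces : ∀ p ∈ pieces, p⁻¹ ∈ pieces
  one_notMem_pieces : (1 : FreeGroup S) ∉ pieces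
  /-- the sequence `Δ(g)` of pieces assigned to `g` -/
  toFun : FreeGroup S → List (FreeGroup S)
  mem_pieces : ∀ g, ∀ p ∈ toFun g, p ∈ pieces
  map_one : toFun 1 = []
  /-- `g = g₁ ⋯ gₖ` as a reduced product: the reduced word of `g` is the concatenation of the
  reduced words of the `gⱼ`. -/
  reduced_product : ∀ g, (toFun g).flatMap FreeGroup.toWord = g.toWord
  map_inv : ∀ g, toFun g⁻¹ = seqInv (toFun g)
  infix_closed : ∀ g l, l <:+: toFun g → toFun l.prod = l
  bounded_rPart : ∃ D : ℕ, ∀ g h, ∀ i : Fin 3, (rPart toFun g h i).length ≤ D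

/-- `φ` is `Δ`-decomposable: `φ(g) = ∑ⱼ λ(gⱼ)` for `Δ(g) = (g₁,…,gₖ)`, where `λ` is a bounded
alternating function on the pieces of `Δ`. -/
def IsDecomposable {S : Type*} [DecidableEq S] (Δ : Decomposition S) (φ : FreeGroup S → ℝ) : Prop :=
  ∃ l : FreeGroup S → ℝ,
    (∃ C : ℝ, ∀ p ∈ Δ.pieces, |l p| ≤ C) ∧
    (∀ p ∈ Δ.pieces, l p⁻¹ = -l p) ∧
    ∀ g, φ g = ((Δ.toFun g).map l).sum

/-- `ψ` is a `Δ`-continuous quasimorphism: it is an alternating quasimorphism and there is a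
non-negative summable sequence `x` with `|δ¹ψ(g, h) - δ¹ψ(g', h')| ≤ x_N` for all
`(g, h) ≠ (g', h')`, where `N = N_Δ((g, h), (g', h'))`. -/
def IsDeltaContinuous {S : Type*} [DecidableEq S] (Δ : Decomposition S) (ψ : FreeGroup S → ℝ) :
    Prop :=
  IsQuasimorphism ψ ∧ IsAlternating ψ ∧
    ∃ x : ℕ → ℝ, (∀ j, 0 ≤ x j) ∧ Summable x ∧
      ∀ p p' : FreeGroup S × FreeGroup S, p ≠ p' →
        ∀ N : ℕ, triangleOverlap Δ.toFun p p' = N →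
          |(ψ p.1 + ψ p.2 - ψ (p.1 * p.2)) - (ψ p'.1 + ψ p'.2 - ψ (p'.1 * p'.2))| ≤ x N

/-! ## Free products of quasimorphisms -/

/-- The free product `*ᵢ φᵢ` of functions `φᵢ : Gᵢ → ℝ`: if `g = g₁ ⋯ gₖ` is the normal form of an
element of the free product, with `1 ≠ gⱼ ∈ G_{i_j}` and `i_j ≠ i_{j+1}`, then
`(*ᵢ φᵢ)(g) = ∑ⱼ φ_{i_j}(gⱼ)`. -/
def freeProductFun {ι : Type*} [DecidableEq ι] {G : ι → Type*} [∀ i, Group (G i)]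
    [∀ i, DecidableEq (G i)] (φ : ∀ i, G i → ℝ) (g : Monoid.CoprodI G) : ℝ :=
  ((Monoid.CoprodI.Word.equiv g).toList.map fun x => φ x.1 x.2).sum

/-! Write `φ` for the free product of the `φᵢ`, and let `ω` be any bounded 2-cocycle. Then `δφ ⌣ ω =
δ(φ ⌣ ω)`, but `φ ⌣ ω` is unbounded. It becomes bounded after adding the coboundary `δη`, where
`η(g, h) = ∑ⱼ l(pⱼ) (ω(zⱼ, h) + ω(pⱼzⱼ, h)) / 2`, `(p₁,…,pₖ)` is the sequence of pieces of `g`, `zⱼ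
= pⱼ₊₁ ⋯ pₖ`, and `φ(g) = ∑ⱼ l(pⱼ)`.

The cocycle identity (`tailSum_cocycle`) cancels `φ(g) ω(h, i)` and turns `(φ ⌣ ω + δη)(g, h, i)`
into a signed sum of `ω(·, i)` along the three sides of the triangle `g`, `h`, `gh`. If triangles
are tripods up to a bounded centre, the legs cancel and only the centre contributes
(`tailSum_triangle_le`). The average over both ends of each letter makes the leg shared by `g` and
`h`, which they traverse in opposite directions, cancel exactly.

It remains to show that triangles are thin. In one free group this needs the legs of a `Δ`-triangle
not to overlap (`Decomposition.eq_nil_of_overlap`). In the free product, normal forms make a tripod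
whose centre is empty or has one syllable on each side, and that centre is refined by a triangle of
the corresponding `Δᵢ` (`exists_isThinTriangle_freeProductSeq`).

For the free product of the `ψᵢ` the same tripod of syllables reduces the defect to that of a single
factor, or to zero. -/

/-! ## Symmetrised weighted sums along a sequence -/

section WeightedSum

variable {G P : Type*} [Group G]

/-- The element of `G` spelled by a sequence of letters. -/
def spell (ev : P → G) (L : List P) : G := (L.map ev).prod

/-- For `L = (p₁,…,pₖ)` with tails `zⱼ = pⱼ₊₁ ⋯ pₖ z`, the sum
`∑ⱼ l(pⱼ) (f(zⱼ) + f(pⱼ zⱼ)) / 2`. -/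
noncomputable def tailSum (ev : P → G) (l : P → ℝ) (f : G → ℝ) : List P → G → ℝ
  | [], _ => 0
  | p :: L, z =>
    l p * ((f (spell ev L * z) + f (ev p * spell ev L * z)) / 2) + tailSum ev l f L z

theorem spell_nil (ev : P → G) : spell ev [] = 1 := rfl

theorem spell_cons (ev : P → G) (p : P) (L : List P) :
    spell ev (p :: L) = ev p * spell ev L := by simp [spell]

theorem spell_append (ev : P → G) (L M : List P) :
    spell ev (L ++ M) = spell ev L * spell ev M := by simp [spell]

theorem spell_reverse_map {ev : P → G} {inv : P → P} (hev : ∀ p, ev (inv p) = (ev p)⁻¹)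
    (L : List P) : spell ev (L.map inv).reverse = (spell ev L)⁻¹ := by
  induction L with
  | nil => simp [spell]
  | cons p L ih => simp [spell_append, spell_cons, spell_nil, ih, hev]

theorem tailSum_append (ev : P → G) (l : P → ℝ) (f : G → ℝ) (L M : List P) (z : G) :
    tailSum ev l f (L ++ M) z = tailSum ev l f L (spell ev M * z) + tailSum ev l f M z := by
  induction L with
  | nil => simp [tailSum]
  | cons p L ih => simp [tailSum, ih, spell_append, mul_assoc, add_assoc]

/-- Reading a path backwards exchanges the two ends `z` and `pz` of every letter, which leaves their
average unchanged, and inverts the letter, which changes the sign of its weight. -/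
theorem tailSum_reverse_map {ev : P → G} {inv : P → P} {l : P → ℝ}
    (hev : ∀ p, ev (inv p) = (ev p)⁻¹) (hl : ∀ p, l (inv p) = -l p) (f : G → ℝ) (L : List P)
    (z : G) :
    tailSum ev l f (L.map inv).reverse (spell ev L * z) = -tailSum ev l f L z := by
  induction L generalizing z with
  | nil => simp [tailSum]
  | cons p L ih =>
    have h := ih z
    simp only [List.map_cons, List.reverse_cons, tailSum_append, tailSum, spell_cons, spell_nil,
      hev, hl, mul_one, one_mul, mul_assoc, inv_mul_cancel_left] at h ⊢
    rw [h]
    ring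

theorem abs_tailSum_le {ev : P → G} {l : P → ℝ} {f : G → ℝ} {C B : ℝ} (hC : ∀ p, |l p| ≤ C)
    (hB : ∀ g, |f g| ≤ B) (L : List P) (z : G) :
    |tailSum ev l f L z| ≤ L.length * (C * B) := by
  induction L with
  | nil => simp [tailSum]
  | cons p L ih =>
    have h : |(f (spell ev L * z) + f (ev p * spell ev L * z)) / 2| ≤ B := by
      have h1 := abs_le.1 (hB (spell ev L * z))
      have h2 := abs_le.1 (hB (ev p * spell ev L * z))
      exact abs_le.2 ⟨by linarith, by linarith⟩
    calc _ ≤ _ := abs_add_le _ _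
      _ ≤ C * B + L.length * (C * B) := by
        rw [abs_mul]
        exact add_le_add (mul_le_mul (hC p) h (abs_nonneg _) ((abs_nonneg _).trans (hC p))) ih
      _ = _ := by push_cast [List.length_cons]; ring

/-- The cocycle identity reads `ω(z, hi) - ω(z, h) = ω(zh, i) - ω(h, i)`. Averaged over both ends of
each letter and weighted by `l`, its last term no longer depends on the letter and collects the
total weight. -/
theorem tailSum_cocycle (ev : P → G) (l : P → ℝ) {ω : G → G → ℝ}
    (hω : ∀ z h i, ω h i - ω (z * h) i + ω z (h * i) - ω z h = 0) (L : List P) (h i : G) :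
    tailSum ev l (fun z => ω z (h * i)) L 1 - tailSum ev l (fun z => ω z h) L 1 =
      tailSum ev l (fun z => ω z i) L h - (L.map l).sum * ω h i := by
  induction L with
  | nil => simp [tailSum]
  | cons p L ih =>
    have h1 := hω (spell ev L) h i
    have h2 := hω (ev p * spell ev L) h i
    simp only [tailSum, List.map_cons, List.sum_cons, mul_one]
    linear_combination ih + l p / 2 * h1 + l p / 2 * h2

theorem abs_sum_map_le {l : P → ℝ} {C : ℝ} (hC : ∀ p, |l p| ≤ C) (L : List P) :
    |(L.map l).sum| ≤ L.length * C := by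
  induction L with
  | nil => simp
  | cons p L ih =>
    rw [List.map_cons, List.sum_cons]
    calc _ ≤ _ := abs_add_le _ _
      _ ≤ C + L.length * C := add_le_add (hC p) ih
      _ = _ := by push_cast [List.length_cons]; ring

theorem sum_map_reverse_map {inv : P → P} {l : P → ℝ} (hl : ∀ p, l (inv p) = -l p) (L : List P) :
    ((L.map inv).reverse.map l).sum = -(L.map l).sum := by
  induction L with
  | nil => simp
  | cons p L ih => simp_all

end WeightedSum

/-! ## Thin triangles and vanishing cup products -/

section ThinTriangles

variable {G P : Type*} [Group G]

/-- The triangle of sequences `Δ(g)`, `Δ(h)`, `Δ(gh)` is a tripod outside of a centre whose sides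
have length at most `D`; `inv` is the inversion of letters. -/
def IsThinTriangle (inv : P → P) (D : ℕ) (L M N : List P) : Prop :=
  ∃ a b c r₁ r₂ r₃ : List P,
    L = a ++ r₁ ++ b ∧ M = (b.map inv).reverse ++ r₂ ++ c ∧ N = a ++ r₃ ++ c ∧
      r₁.length ≤ D ∧ r₂.length ≤ D ∧ r₃.length ≤ D

variable {ev : P → G} {inv : P → P} {l : P → ℝ} {seq : G → List P} {D : ℕ} {C : ℝ}

/-- The legs cancel, one of them because `l` is alternating, so only the three sides of the centre
count. -/
theorem isQuasimorphism_of_isThinTriangle (hC : ∀ p, |l p| ≤ C) (hl : ∀ p, l (inv p) = -l p)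
    (hseq : ∀ g h, IsThinTriangle inv D (seq g) (seq h) (seq (g * h))) :
    IsQuasimorphism fun g => ((seq g).map l).sum := by
  refine ⟨3 * (D * |C|), fun g h => ?_⟩
  obtain ⟨a, b, c, r₁, r₂, r₃, e₁, e₂, e₃, h₁, h₂, h₃⟩ := hseq g h
  have key : ∀ r : List P, r.length ≤ D → |(r.map l).sum| ≤ D * |C| := fun r hr =>
    (abs_sum_map_le (fun p => (hC p).trans (le_abs_self C)) r).trans
      (mul_le_mul_of_nonneg_right (by exact_mod_cast hr) (abs_nonneg _))
  have k₁ := abs_le.1 (key r₁ h₁)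
  have k₂ := abs_le.1 (key r₂ h₂)
  have k₃ := abs_le.1 (key r₃ h₃)
  have hb := sum_map_reverse_map hl b
  simp only [e₁, e₂, e₃, List.map_append, List.sum_append, hb]
  exact abs_le.2 ⟨by linarith, by linarith⟩

/-- The side of `g` is based at `h`, so that all three sides lie on one triangle. Each leg is then
summed twice with opposite signs over the same group elements. -/
theorem tailSum_triangle_le (hev : ∀ p, ev (inv p) = (ev p)⁻¹) (hC₀ : 0 ≤ C)
    (hC : ∀ p, |l p| ≤ C) (hl : ∀ p, l (inv p) = -l p) (hspell : ∀ g, spell ev (seq g) = g)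
    (hseq : ∀ g h, IsThinTriangle inv D (seq g) (seq h) (seq (g * h)))
    {f : G → ℝ} {B : ℝ} (hB : ∀ g, |f g| ≤ B) (g h : G) :
    |tailSum ev l f (seq g) h + tailSum ev l f (seq h) 1 - tailSum ev l f (seq (g * h)) 1| ≤
      3 * (D * (C * B)) := by
  obtain ⟨a, b, c, r₁, r₂, r₃, e₁, e₂, e₃, h₁, h₂, h₃⟩ := hseq g h
  have s₁ := hspell g
  have s₂ := hspell h
  have s₃ := hspell (g * h)
  have key : ∀ (r : List P) (z : G), r.length ≤ D → |tailSum ev l f r z| ≤ D * (C * B) :=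
    fun r z hr => (abs_tailSum_le hC hB r z).trans
      (mul_le_mul_of_nonneg_right (by exact_mod_cast hr)
        (mul_nonneg hC₀ ((abs_nonneg _).trans (hB 1))))
  have k₁ := abs_le.1 (key r₁ (spell ev b * h) h₁)
  have k₂ := abs_le.1 (key r₂ (spell ev c) h₂)
  have k₃ := abs_le.1 (key r₃ (spell ev c) h₃)
  rw [e₁, spell_append, spell_append] at s₁
  rw [e₂, spell_append, spell_append, spell_reverse_map hev] at s₂
  rw [e₃, spell_append, spell_append] at s₃
  -- `m₁` matches the base points of the two passes through `b`, and `m₂` those of the two passes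
  -- through `a`. Both passes through `c` are based at `1`.
  have m₁ : spell ev r₂ * spell ev c = spell ev b * h := by rw [← s₂]; group
  have m₂ : spell ev r₁ * (spell ev b * h) = spell ev r₃ * spell ev c := by
    refine mul_left_cancel (a := spell ev a) ?_
    rw [← mul_assoc _ _ (spell ev c), s₃, ← mul_assoc, ← mul_assoc, s₁]
  have hb := tailSum_reverse_map hev hl f b h
  simp only [e₁, e₂, e₃, tailSum_append, mul_one, m₁, m₂, hb]
  exact abs_le.2 ⟨by linarith, by linarith⟩

theorem barδ_two_apply (f : (Fin 2 → G) → ℝ) (g : Fin 3 → G) :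
    barδ G 2 f g = f ![g 1, g 2] - f ![g 0 * g 1, g 2] + f ![g 0, g 1 * g 2] - f ![g 0, g 1] := by
  have h₀ : (fun i : Fin 2 => g i.succ) = ![g 1, g 2] := by
    ext i; fin_cases i <;> rfl
  have h₁ : Fin.contractNth 0 (· * ·) g = ![g 0 * g 1, g 2] := by
    ext i; fin_cases i <;> rfl
  have h₂ : Fin.contractNth 1 (· * ·) g = ![g 0, g 1 * g 2] := by
    ext i; fin_cases i <;> rfl
  have h₃ : Fin.contractNth 2 (· * ·) g = ![g 0, g 1] := by
    ext i; fin_cases i <;> rfl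
  have h : barδ G 2 f g = f (fun i : Fin 2 => g i.succ) +
      ∑ j : Fin 3, (-1 : ℝ) ^ ((j : ℕ) + 1) * f (Fin.contractNth (n := 2) j (· * ·) g) := rfl
  rw [h, Fin.sum_univ_three, h₀, h₁, h₂, h₃]
  norm_num
  ring

theorem barδ_three_apply (f : (Fin 3 → G) → ℝ) (g : Fin 4 → G) :
    barδ G 3 f g = f ![g 1, g 2, g 3] - f ![g 0 * g 1, g 2, g 3] + f ![g 0, g 1 * g 2, g 3] -
      f ![g 0, g 1, g 2 * g 3] + f ![g 0, g 1, g 2] := by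
  have h₀ : (fun i : Fin 3 => g i.succ) = ![g 1, g 2, g 3] := by
    ext i; fin_cases i <;> rfl
  have h₁ : Fin.contractNth 0 (· * ·) g = ![g 0 * g 1, g 2, g 3] := by
    ext i; fin_cases i <;> rfl
  have h₂ : Fin.contractNth 1 (· * ·) g = ![g 0, g 1 * g 2, g 3] := by
    ext i; fin_cases i <;> rfl
  have h₃ : Fin.contractNth 2 (· * ·) g = ![g 0, g 1, g 2 * g 3] := by
    ext i; fin_cases i <;> rfl
  have h₄ : Fin.contractNth 3 (· * ·) g = ![g 0, g 1, g 2] := by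
    ext i; fin_cases i <;> rfl
  have h : barδ G 3 f g = f (fun i : Fin 3 => g i.succ) +
      ∑ j : Fin 4, (-1 : ℝ) ^ ((j : ℕ) + 1) * f (Fin.contractNth (n := 3) j (· * ·) g) := rfl
  rw [h, Fin.sum_univ_four, h₀, h₁, h₂, h₃, h₄]
  norm_num [pow_succ]
  ring

theorem barδ_three_barδ_two (f : (Fin 2 → G) → ℝ) : barδ G 3 (barδ G 2 f) = 0 := by
  ext g
  simp [barδ_three_apply, barδ_two_apply, mul_assoc]
  ring

theorem cochainCup_barδ_mem_boundedCoboundaries (hev : ∀ p, ev (inv p) = (ev p)⁻¹)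
    (hC₀ : 0 ≤ C) (hC : ∀ p, |l p| ≤ C) (hl : ∀ p, l (inv p) = -l p)
    (hspell : ∀ g, spell ev (seq g) = g)
    (hseq : ∀ g h, IsThinTriangle inv D (seq g) (seq h) (seq (g * h)))
    {ω : (Fin 2 → G) → ℝ} (hω : ω ∈ boundedCocycles G 2) :
    cochainCup (show 2 + 2 = 4 from rfl)
      (barδ G 1 (toCochain fun g => ((seq g).map l).sum)) ω ∈ boundedCoboundaries G 4 := by
  obtain ⟨⟨B, hB⟩, hω₀⟩ := hω
  rw [SetLike.mem_coe, LinearMap.mem_ker] at hω₀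
  set φ : G → ℝ := fun g => ((seq g).map l).sum with hφ
  set η : (Fin 2 → G) → ℝ := fun g => tailSum ev l (fun z => ω ![z, g 1]) (seq (g 0)) 1 with hη
  have hcoc : ∀ z h i, ω ![h, i] - ω ![z * h, i] + ω ![z, h * i] - ω ![z, h] = 0 := by
    intro z h i
    have := congrFun hω₀ ![z, h, i]
    rw [barδ_two_apply] at this
    simpa using this
  -- The summand `barδ G 2 η` leaves the coboundary unchanged and serves only to make the primitive
  -- bounded.
  refine ⟨cochainCup (show 1 + 2 = 3 from rfl) (toCochain φ) ω + barδ G 2 η,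
    ⟨3 * (D * (C * B)), fun g => ?_⟩, ?_⟩
  · have hcup : cochainCup (show 1 + 2 = 3 from rfl) (toCochain φ) ω g =
        φ (g 0) * ω ![g 1, g 2] := by
      rw [cochainCup_apply]
      congr 2
      ext i
      fin_cases i <;> rfl
    have h₁ := tailSum_triangle_le hev hC₀ hC hl hspell hseq (f := fun z => ω ![z, g 2])
      (fun z => hB _) (g 0) (g 1)
    have h₂ := tailSum_cocycle ev l (ω := fun z h => ω ![z, h]) hcoc (seq (g 0)) (g 1) (g 2)
    rw [Pi.add_apply, hcup, barδ_two_apply]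
    simp only [hη, hφ, Matrix.cons_val_zero, Matrix.cons_val_one] at h₂ ⊢
    refine le_of_eq_of_le (congrArg _ ?_) h₁
    linear_combination h₂
  · rw [map_add, barδ_three_barδ_two, barδ_cochainCup, hω₀]
    simp

end ThinTriangles
/-! ## Triangles of a decomposition -/

section DecompositionTriangles

theorem commonPrefix_prefix_left {G : Type*} [DecidableEq G] (l m : List G) :
    commonPrefix l m <+: l := by
  fun_induction commonPrefix l m with
  | case1 a l m ih => exact List.cons_prefix_cons.2 ⟨rfl, ih⟩
  | case2 => exact List.nil_prefix
  | case3 => exact List.nil_prefix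

theorem commonPrefix_prefix_right {G : Type*} [DecidableEq G] (l m : List G) :
    commonPrefix l m <+: m := by
  fun_induction commonPrefix l m with
  | case1 a l m ih => exact List.cons_prefix_cons.2 ⟨rfl, ih⟩
  | case2 => exact List.nil_prefix
  | case3 => exact List.nil_prefix

theorem commonSuffix_suffix_left {G : Type*} [DecidableEq G] (l m : List G) :
    commonSuffix l m <:+ l := by
  simpa [commonSuffix] using List.reverse_suffix.2 (commonPrefix_prefix_left l.reverse m.reverse)

theorem commonSuffix_suffix_right {G : Type*} [DecidableEq G] (l m : List G) :
    commonSuffix l m <:+ m := by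
  simpa [commonSuffix] using List.reverse_suffix.2 (commonPrefix_prefix_right l.reverse m.reverse)

theorem seqInv_append {G : Type*} [Group G] (l m : List G) :
    seqInv (l ++ m) = seqInv m ++ seqInv l := by simp [seqInv]

theorem seqInv_seqInv {G : Type*} [Group G] (l : List G) : seqInv (seqInv l) = l := by
  simp [seqInv]

theorem length_seqInv {G : Type*} [Group G] (l : List G) : (seqInv l).length = l.length := by
  simp [seqInv]

theorem middle_append {G : Type*} (a r b : List G) :
    middle (a ++ r ++ b) a.length b.length = r := by
  have : (a ++ r ++ b).length - a.length - b.length = r.length := by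
    simp only [List.length_append]; omega
  rw [middle, this, List.append_assoc, List.drop_left, List.take_left]

namespace Decomposition

variable {S : Type*} [DecidableEq S] (Δ : Decomposition S)

theorem prod_toFun (g : FreeGroup S) : (Δ.toFun g).prod = g := by
  have h : ∀ L : List (FreeGroup S), FreeGroup.mk (L.flatMap FreeGroup.toWord) = L.prod := by
    intro L
    induction L with
    | nil => rfl
    | cons x L ih =>
      rw [List.flatMap_cons, ← FreeGroup.mul_mk, ih, FreeGroup.mk_toWord, List.prod_cons]
  rw [← h, Δ.reduced_product, FreeGroup.mk_toWord]

/-- An infix is the decomposition of its own product, and decompositions are reduced products. -/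
theorem norm_prod_of_infix {g : FreeGroup S} {L : List (FreeGroup S)} (h : L <:+: Δ.toFun g) :
    L.prod.norm = (L.map FreeGroup.norm).sum := by
  have := Δ.reduced_product L.prod
  rw [Δ.infix_closed g L h] at this
  rw [FreeGroup.norm, ← this, List.length_flatMap]
  rfl

theorem norm_prod_append_of_infix {g : FreeGroup S} {L M : List (FreeGroup S)}
    (h : L ++ M <:+: Δ.toFun g) : (L ++ M).prod.norm = L.prod.norm + M.prod.norm := by
  rw [Δ.norm_prod_of_infix h, Δ.norm_prod_of_infix ((List.prefix_append L M).isInfix.trans h),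
    Δ.norm_prod_of_infix ((List.suffix_append L M).isInfix.trans h), List.map_append,
    List.sum_append]

/-- A common initial segment of `Δ(g)`, `Δ(gh)` and a common final segment of `Δ(g)`, `Δ(h⁻¹)` do
not overlap. -/
theorem eq_nil_of_overlap {g h : FreeGroup S} {A M B X T : List (FreeGroup S)}
    (hg : Δ.toFun g = A ++ M ++ B) (hgh : Δ.toFun (g * h) = A ++ M ++ X)
    (hh : Δ.toFun h⁻¹ = T ++ M ++ B) : M = [] := by
  have p₁ := Δ.prod_toFun g
  have p₂ := Δ.prod_toFun (g * h)
  have p₃ := Δ.prod_toFun h⁻¹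
  have n₁ := Δ.norm_prod_append_of_infix (g := g * h) (L := M) (M := X)
    (by rw [hgh, List.append_assoc]; exact (List.suffix_append _ _).isInfix)
  have n₂ := Δ.norm_prod_append_of_infix (g := h⁻¹) (L := T) (M := M)
    (by rw [hh]; exact (List.prefix_append _ _).isInfix)
  rw [hg, List.prod_append, List.prod_append] at p₁
  rw [hgh, List.prod_append, List.prod_append] at p₂
  rw [hh, List.prod_append, List.prod_append] at p₃
  have e : h = B.prod⁻¹ * X.prod := by
    rw [← p₁] at p₂
    refine mul_left_cancel (a := A.prod * M.prod * B.prod) ?_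
    rw [← p₂]; group
  have e₁ : (T ++ M).prod = X.prod⁻¹ := by
    rw [List.prod_append]
    refine mul_right_cancel (b := B.prod) ?_
    rw [p₃, e]; group
  have e₂ : (M ++ X).prod = T.prod⁻¹ := by
    rw [List.prod_append] at e₁ ⊢
    rw [← inv_inj, mul_inv_rev, ← e₁]; group
  rw [e₁, FreeGroup.norm_inv_eq] at n₂
  rw [e₂, FreeGroup.norm_inv_eq] at n₁
  -- Since `TM = X⁻¹` and `MX = T⁻¹` are both reduced, `|X| = |T| + |M|` and `|T| = |M| + |X|`,
  -- which forces `|M| = 0`.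
  have hM : M.prod = 1 := FreeGroup.norm_eq_zero.1 (by omega)
  have := Δ.infix_closed g M (by rw [hg]; exact ⟨A, B, rfl⟩)
  rw [← this, hM, Δ.map_one]

/-- `middle` uses truncated subtraction, so it is the true complement of the two legs only once
these are known not to overlap. -/
theorem exists_eq_append {g h : FreeGroup S} {p q : List (FreeGroup S)} (h₁ : p <+: Δ.toFun g)
    (h₂ : p <+: Δ.toFun (g * h)) (h₃ : q <:+ Δ.toFun g) (h₄ : q <:+ Δ.toFun h⁻¹) :
    ∃ r, Δ.toFun g = p ++ r ++ q := by
  obtain ⟨x, hx⟩ := h₁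
  obtain ⟨y, hy⟩ := h₃
  obtain ⟨x', hx'⟩ := h₂
  obtain ⟨y', hy'⟩ := h₄
  rcases List.append_eq_append_iff.1 (hx.trans hy.symm) with ⟨r, h, h'⟩ | ⟨M, rfl, rfl⟩
  · exact ⟨r, by rw [← hx, h', List.append_assoc]⟩
  · have hM := Δ.eq_nil_of_overlap hx.symm hx'.symm (by rw [← hy', List.append_assoc])
    subst hM
    exact ⟨[], by simpa using hx.symm⟩

theorem exists_isThinTriangle : ∃ D : ℕ, ∀ g h : FreeGroup S,
    IsThinTriangle (·⁻¹) D (Δ.toFun g) (Δ.toFun h) (Δ.toFun (g * h)) := by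
  obtain ⟨D, hD⟩ := Δ.bounded_rPart
  refine ⟨D, fun g h => ?_⟩
  have b₁ := hD g h 0
  have b₂ := hD g h 1
  have b₃ := hD g h 2
  simp only [rPart, cPart, Matrix.cons_val_zero, Matrix.cons_val_one, Matrix.cons_val,
    length_seqInv] at b₁ b₂ b₃
  set a := commonPrefix (Δ.toFun g) (Δ.toFun (g * h)) with ha
  set b := commonSuffix (Δ.toFun g) (Δ.toFun h⁻¹) with hb
  set c := commonSuffix (Δ.toFun h) (Δ.toFun (g * h)) with hc
  have inv_pre : ∀ {x : List (FreeGroup S)} {k}, x <:+ Δ.toFun k → seqInv x <+: Δ.toFun k⁻¹ := by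
    rintro x k ⟨y, hy⟩
    rw [Δ.map_inv, ← hy, seqInv_append]
    exact List.prefix_append _ _
  have inv_suf : ∀ {x : List (FreeGroup S)} {k}, x <+: Δ.toFun k → seqInv x <:+ Δ.toFun k⁻¹ := by
    rintro x k ⟨y, hy⟩
    rw [Δ.map_inv, ← hy, seqInv_append]
    exact List.suffix_append _ _
  have a₁ : a <+: Δ.toFun g := commonPrefix_prefix_left _ _
  have a₂ : a <+: Δ.toFun (g * h) := commonPrefix_prefix_right _ _
  have d₁ : b <:+ Δ.toFun g := commonSuffix_suffix_left _ _
  have d₂ : b <:+ Δ.toFun h⁻¹ := commonSuffix_suffix_right _ _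
  have c₁ : c <:+ Δ.toFun h := commonSuffix_suffix_left _ _
  have c₂ : c <:+ Δ.toFun (g * h) := commonSuffix_suffix_right _ _
  obtain ⟨r₁, e₁⟩ := Δ.exists_eq_append a₁ a₂ d₁ d₂
  -- The other two sides follow by symmetry: the triangle is read from `h⁻¹`, with third side
  -- `(gh)⁻¹`, and then from `gh`, with third side `g`.
  obtain ⟨r₂, e₂⟩ := Δ.exists_eq_append (g := h⁻¹) (h := g⁻¹) (inv_pre c₁)
    (by simpa using inv_pre c₂) d₂ (by simpa using d₁)
  obtain ⟨r₃, e₃⟩ := Δ.exists_eq_append (g := g * h) (h := h⁻¹) a₂ (by simpa using a₁) c₂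
    (by simpa using c₁)
  have e₂' : Δ.toFun h = seqInv b ++ seqInv r₂ ++ c := by
    rw [← inv_inv h, Δ.map_inv, e₂, seqInv_append, seqInv_append, seqInv_seqInv,
      List.append_assoc]
  refine ⟨a, b, c, r₁, seqInv r₂, r₃, e₁, e₂', e₃, ?_, ?_, ?_⟩
  · rwa [e₁, middle_append] at b₁
  · rwa [e₂', ← length_seqInv b, middle_append] at b₂
  · rwa [e₃, middle_append] at b₃

end Decomposition

end DecompositionTriangles
/-! ## Triangles of normal forms in a free product -/

section FreeProductTriangles

open Monoid

variable {ι : Type*} {M : ι → Type*} [∀ i, Group (M i)]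

/-- A sequence of syllables is reduced if no syllable is trivial and adjacent syllables are from
different factors. -/
def IsReducedSeq (L : List (Σ i, M i)) : Prop :=
  (∀ x ∈ L, x.2 ≠ 1) ∧ L.IsChain fun x y => x.1 ≠ y.1

/-- The inverse of a syllable. -/
def syllableInv (x : Σ i, M i) : Σ i, M i := ⟨x.1, x.2⁻¹⟩

/-- A syllable as an element of the free product. -/
def ofSyllable (x : Σ i, M i) : CoprodI M := CoprodI.of x.2

theorem ofSyllable_syllableInv (x : Σ i, M i) :
    ofSyllable (syllableInv x) = (ofSyllable x)⁻¹ :=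
  map_inv CoprodI.of x.2

/-- The centre of a triangle of normal forms: either it is empty, or it consists of syllables
`x`, `y`, `xy` of the same factor. -/
inductive IsSyllableCentre :
    List (Σ i, M i) → List (Σ i, M i) → List (Σ i, M i) → Prop
  | nil : IsSyllableCentre [] [] []
  | mul (i : ι) (x y : M i) : IsSyllableCentre [⟨i, x⟩] [⟨i, y⟩] [⟨i, x * y⟩]

theorem IsSyllableCentre.spell_eq {r₁ r₂ r₃ : List (Σ i, M i)} (h : IsSyllableCentre r₁ r₂ r₃) :
    spell ofSyllable r₃ = spell ofSyllable r₁ * spell ofSyllable r₂ := by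
  cases h <;> simp [spell, ofSyllable]

/-- The product of two reduced sequences, the first of them written backwards. -/
theorem exists_reduced_triangle [DecidableEq ι] (L N : List (Σ i, M i))
    (hL : IsReducedSeq L.reverse) (hN : IsReducedSeq N) :
    ∃ a b c r₁ r₂ r₃ : List (Σ i, M i), L.reverse = a ++ r₁ ++ b ∧
      N = (b.map syllableInv).reverse ++ r₂ ++ c ∧ IsReducedSeq (a ++ r₃ ++ c) ∧
      IsSyllableCentre r₁ r₂ r₃ := by
  -- As the first sequence is reversed, the heads of `L` and `N` meet at the seam. They cancel and
  -- lengthen the leg `b`, or merge into one syllable, or lie in different factors; the last two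
  -- cases end the recursion.
  induction L generalizing N with
  | nil => exact ⟨[], [], N, [], [], [], by simp, by simp, by simpa using hN, .nil⟩
  | cons x L ih =>
    cases N with
    | nil => exact ⟨(x :: L).reverse, [], [], [], [], [], by simp, by simp, by simpa using hL, .nil⟩
    | cons y N =>
      obtain ⟨i, x⟩ := x
      obtain ⟨j, y⟩ := y
      by_cases hij : i = j
      · subst hij
        by_cases hxy : x * y = 1
        · have hL' : IsReducedSeq L.reverse := by
            rw [List.reverse_cons] at hL
            exact ⟨fun z hz => hL.1 z (List.mem_append_left _ hz),
              (List.isChain_append.1 hL.2).1⟩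
          have hN' : IsReducedSeq N :=
            ⟨fun z hz => hN.1 z (List.mem_cons_of_mem _ hz), hN.2.tail⟩
          obtain ⟨a, b, c, r₁, r₂, r₃, h₁, h₂, h₃, h₄⟩ := ih N hL' hN'
          refine ⟨a, b ++ [⟨i, x⟩], c, r₁, r₂, r₃, ?_, ?_, h₃, h₄⟩
          · simp [h₁]
          · simp [h₂, syllableInv, eq_inv_of_mul_eq_one_right hxy]
        · refine ⟨L.reverse, [], N, [⟨i, x⟩], [⟨i, y⟩], [⟨i, x * y⟩], by simp, by simp, ⟨?_, ?_⟩,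
            .mul i x y⟩
          · intro z hz
            simp only [List.append_assoc, List.mem_append, List.mem_cons, List.not_mem_nil,
              or_false] at hz
            rcases hz with hz | rfl | hz
            · exact hL.1 z (by rw [List.reverse_cons]; exact List.mem_append_left _ hz)
            · exact hxy
            · exact hN.1 z (List.mem_cons_of_mem _ hz)
          · have h₁ := hL.2
            have h₂ := hN.2
            rw [List.reverse_cons, List.isChain_append] at h₁
            rw [List.isChain_cons] at h₂
            rw [List.append_assoc, List.singleton_append, List.isChain_append, List.isChain_cons]
            refine ⟨h₁.1, ⟨h₂.1, h₂.2⟩, ?_⟩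
            simpa using h₁.2.2
      · refine ⟨(⟨i, x⟩ :: L).reverse, [], ⟨j, y⟩ :: N, [], [], [], by simp, by simp, ⟨?_, ?_⟩, .nil⟩
        · intro z hz
          rw [List.append_nil, List.mem_append] at hz
          exact hz.elim (hL.1 z) (hN.1 z)
        · rw [List.append_nil, List.isChain_append]
          refine ⟨hL.2, hN.2, ?_⟩
          simpa using hij

variable [DecidableEq ι] [∀ i, DecidableEq (M i)]

/-- The normal form of an element of a free product. -/
def normalForm (g : CoprodI M) : List (Σ i, M i) := (CoprodI.Word.equiv g).toList

theorem isReducedSeq_normalForm (g : CoprodI M) : IsReducedSeq (normalForm g) :=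
  ⟨(CoprodI.Word.equiv g).ne_one, (CoprodI.Word.equiv g).chain_ne⟩

theorem spell_normalForm (g : CoprodI M) : spell ofSyllable (normalForm g) = g :=
  CoprodI.Word.equiv.symm_apply_apply g

theorem normalForm_eq {g : CoprodI M} {L : List (Σ i, M i)} (hL : IsReducedSeq L)
    (hg : spell ofSyllable L = g) : normalForm g = L := by
  have h : CoprodI.Word.equiv g = ⟨L, hL.1, hL.2⟩ := by
    rw [← Equiv.eq_symm_apply]
    exact hg.symm
  rw [normalForm, h]

/-- The reduced sequence left after cancellation spells `gh`, so it is the normal form by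
uniqueness. -/
theorem exists_normalForm_triangle (g h : CoprodI M) :
    ∃ a b c r₁ r₂ r₃ : List (Σ i, M i), normalForm g = a ++ r₁ ++ b ∧
      normalForm h = (b.map syllableInv).reverse ++ r₂ ++ c ∧
      normalForm (g * h) = a ++ r₃ ++ c ∧ IsSyllableCentre r₁ r₂ r₃ := by
  obtain ⟨a, b, c, r₁, r₂, r₃, h₁, h₂, h₃, h₄⟩ := exists_reduced_triangle
    (normalForm g).reverse (normalForm h) (by simpa using isReducedSeq_normalForm g)
    (isReducedSeq_normalForm h)
  rw [List.reverse_reverse] at h₁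
  refine ⟨a, b, c, r₁, r₂, r₃, h₁, h₂, normalForm_eq h₃ ?_, h₄⟩
  rw [← spell_normalForm g, ← spell_normalForm h, h₁, h₂]
  simp only [spell_append, spell_reverse_map ofSyllable_syllableInv, h₄.spell_eq]
  group

theorem freeProductFun_eq (φ : ∀ i, M i → ℝ) (g : CoprodI M) :
    freeProductFun φ g = ((normalForm g).map fun x => φ x.1 x.2).sum := rfl

/-- A free product of finitely many alternating quasimorphisms is a quasimorphism. -/
theorem isQuasimorphism_freeProductFun [Finite ι] {ψ : ∀ i, M i → ℝ}
    (hψ : ∀ i, IsQuasimorphism (ψ i)) (hψ' : ∀ i, IsAlternating (ψ i)) :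
    IsQuasimorphism (freeProductFun ψ) := by
  choose C hC using hψ
  obtain ⟨B, hB⟩ := (Set.finite_range C).bddAbove
  -- An empty centre gives defect `0`, and `B` may be negative if there are no factors.
  refine ⟨max B 0, fun g h => ?_⟩
  obtain ⟨a, b, c, r₁, r₂, r₃, h₁, h₂, h₃, h₄⟩ := exists_normalForm_triangle g h
  have hb := sum_map_reverse_map (inv := syllableInv) (l := fun x : Σ i, M i => ψ x.1 x.2)
    (fun x => hψ' x.1 x.2) b
  simp only [freeProductFun_eq, h₁, h₂, h₃, List.map_append, List.sum_append, hb]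
  cases h₄ with
  | nil =>
    refine le_of_eq_of_le ?_ (le_max_right B 0)
    simp
  | mul i x y =>
    refine le_trans ?_ ((hC i x y).trans ((hB ⟨i, rfl⟩).trans (le_max_left B 0)))
    simp only [List.map_cons, List.map_nil, List.sum_cons, List.sum_nil]
    exact le_of_eq (congrArg _ (by ring))

end FreeProductTriangles

/-! ## Decompositions of a free product of free groups -/

section FreeProductDecomposition

open Monoid

variable {ι : Type*} {S : ι → Type*} [∀ i, DecidableEq (S i)] (Δ : ∀ i, Decomposition (S i))

/-- The sequence of pieces of a syllable. -/
def syllablePieces (x : Σ i, FreeGroup (S i)) : List (Σ i, FreeGroup (S i)) :=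
  ((Δ x.1).toFun x.2).map (Sigma.mk x.1)

/-- By `Δ(g⁻¹) = Δ(g)⁻¹`, inverse legs of syllables refine to inverse legs of pieces. -/
theorem flatMap_syllablePieces_reverse_map (L : List (Σ i, FreeGroup (S i))) :
    (L.map syllableInv).reverse.flatMap (syllablePieces Δ) =
      ((L.flatMap (syllablePieces Δ)).map syllableInv).reverse := by
  have h : ∀ x : Σ i, FreeGroup (S i), syllablePieces Δ (syllableInv x) =
      ((syllablePieces Δ x).map syllableInv).reverse := by
    intro x
    simp [syllablePieces, syllableInv, Decomposition.map_inv, seqInv, Function.comp_def]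
  induction L with
  | nil => rfl
  | cons x L ih => simp [List.flatMap_append, ih, h]

theorem spell_flatMap_syllablePieces (L : List (Σ i, FreeGroup (S i))) :
    spell ofSyllable (L.flatMap (syllablePieces Δ)) = spell ofSyllable L := by
  have h : ∀ x : Σ i, FreeGroup (S i), spell ofSyllable (syllablePieces Δ x) = ofSyllable x := by
    intro x
    conv_rhs => rw [ofSyllable, ← (Δ x.1).prod_toFun x.2, map_list_prod]
    simp [spell, syllablePieces, ofSyllable, Function.comp_def]
  induction L with
  | nil => rfl
  | cons x L ih => rw [List.flatMap_cons, spell_append, ih, h, spell_cons]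

theorem sum_flatMap_syllablePieces {φ l : ∀ i, FreeGroup (S i) → ℝ}
    (h : ∀ i g, φ i g = (((Δ i).toFun g).map (l i)).sum) (L : List (Σ i, FreeGroup (S i))) :
    ((L.flatMap (syllablePieces Δ)).map fun x => l x.1 x.2).sum =
      (L.map fun x => φ x.1 x.2).sum := by
  induction L with
  | nil => rfl
  | cons x L ih =>
    rw [List.flatMap_cons, List.map_append, List.sum_append, ih, List.map_cons, List.sum_cons, h]
    simp [syllablePieces, Function.comp_def]

variable [DecidableEq ι]

/-- The sequence of pieces of an element of the free product. -/
def freeProductSeq (g : CoprodI fun i => FreeGroup (S i)) : List (Σ i, FreeGroup (S i)) :=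
  (normalForm g).flatMap (syllablePieces Δ)

/-- Syllables can be arbitrarily long in pieces, so a one-syllable centre is not yet bounded. The
`Δᵢ`-triangle of its syllables `x`, `y` has a bounded centre, and its legs are glued to the inner
ends of the syllable legs. -/
theorem exists_isThinTriangle_freeProductSeq [Finite ι] : ∃ D : ℕ, ∀ g h,
    IsThinTriangle syllableInv D (freeProductSeq Δ g) (freeProductSeq Δ h)
      (freeProductSeq Δ (g * h)) := by
  choose D hD using fun i => (Δ i).exists_isThinTriangle
  obtain ⟨B, hB⟩ := (Set.finite_range D).bddAbove
  refine ⟨B, fun g h => ?_⟩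
  obtain ⟨a, b, c, r₁, r₂, r₃, h₁, h₂, h₃, h₄⟩ := exists_normalForm_triangle g h
  simp only [freeProductSeq, h₁, h₂, h₃, List.flatMap_append, flatMap_syllablePieces_reverse_map]
  set f := syllablePieces Δ with hf
  cases h₄ with
  | nil => exact ⟨a.flatMap f, b.flatMap f, c.flatMap f, [], [], [], by simp⟩
  | mul i x y =>
    obtain ⟨a', b', c', s₁, s₂, s₃, e₁, e₂, e₃, l₁, l₂, l₃⟩ := hD i x y
    have hi : D i ≤ B := hB ⟨i, rfl⟩
    refine ⟨a.flatMap f ++ a'.map (Sigma.mk i), b'.map (Sigma.mk i) ++ b.flatMap f,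
      c'.map (Sigma.mk i) ++ c.flatMap f, s₁.map (Sigma.mk i), s₂.map (Sigma.mk i),
      s₃.map (Sigma.mk i), ?_, ?_, ?_, ?_, ?_, ?_⟩
    · simp [hf, syllablePieces, e₁]
    · simp [hf, syllablePieces, e₂, syllableInv, Function.comp_def]
    · simp [hf, syllablePieces, e₃]
    all_goals rw [List.length_map]; omega

/-- A bounded alternating function on the pieces extends to one on the whole group. -/
theorem IsDecomposable.exists_weight {S : Type*} [DecidableEq S] {Δ : Decomposition S}
    {φ : FreeGroup S → ℝ} (h : IsDecomposable Δ φ) :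
    ∃ (l : FreeGroup S → ℝ) (C : ℝ), (∀ p, |l p| ≤ C) ∧ (∀ p, l p⁻¹ = -l p) ∧
      ∀ g, φ g = ((Δ.toFun g).map l).sum := by
  classical
  obtain ⟨l, ⟨C, hC⟩, hl, hφ⟩ := h
  -- Extension by zero stays alternating because the set of pieces is symmetric.
  refine ⟨fun p => if p ∈ Δ.pieces then l p else 0, max C 0, fun p => ?_, fun p => ?_,
    fun g => ?_⟩
  · dsimp only
    split_ifs with hp
    · exact (hC p hp).trans (le_max_left _ _)
    · simp
  · have hp : p⁻¹ ∈ Δ.pieces ↔ p ∈ Δ.pieces :=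
      ⟨fun h => by simpa using Δ.inv_mem_pieces _ h, Δ.inv_mem_pieces p⟩
    by_cases h : p ∈ Δ.pieces
    · simp [hp, h, hl p h]
    · simp [hp, h]
  · rw [hφ]
    exact congrArg _ (List.map_congr_left fun p hp => (if_pos (Δ.mem_pieces g p hp)).symm)

/-- The class of a free product of decomposable quasimorphisms has trivial cup product with every
class in degree two. -/
theorem cochainCup_freeProductFun_mem [Finite ι] {φ : ∀ i, FreeGroup (S i) → ℝ}
    (hφ : ∀ i, IsDecomposable (Δ i) (φ i)) :
    IsQuasimorphism (freeProductFun φ) ∧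
      ∀ ω ∈ boundedCocycles (CoprodI fun i => FreeGroup (S i)) 2,
        cochainCup (show 2 + 2 = 4 from rfl) (barδ _ 1 (toCochain (freeProductFun φ))) ω ∈
          boundedCoboundaries (CoprodI fun i => FreeGroup (S i)) 4 := by
  choose l C hC hl hsum using fun i => (hφ i).exists_weight
  obtain ⟨B, hB⟩ := (Set.finite_range C).bddAbove
  obtain ⟨D, hD⟩ := exists_isThinTriangle_freeProductSeq Δ
  have hC' : ∀ x : Σ i, FreeGroup (S i), |l x.1 x.2| ≤ max B 0 := fun x =>
    (hC x.1 x.2).trans ((hB ⟨x.1, rfl⟩).trans (le_max_left B 0))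
  have hl' : ∀ x : Σ i, FreeGroup (S i), l (syllableInv x).1 (syllableInv x).2 = -l x.1 x.2 :=
    fun x => hl x.1 x.2
  have hφ' : freeProductFun φ =
      fun g => ((freeProductSeq Δ g).map fun x => l x.1 x.2).sum :=
    funext fun g => (sum_flatMap_syllablePieces Δ hsum (normalForm g)).symm
  rw [hφ']
  exact ⟨isQuasimorphism_of_isThinTriangle hC' hl' hD, fun ω hω =>
    cochainCup_barδ_mem_boundedCoboundaries ofSyllable_syllableInv (le_max_right B 0) hC' hl'
      (fun g => (spell_flatMap_syllablePieces Δ _).trans (spell_normalForm g)) hD hω⟩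

end FreeProductDecomposition

/-- Let `F₁, …, Fₙ` be non-abelian free groups of finite rank with bases `S₁, …, Sₙ` and
decompositions `Δ₁, …, Δₙ`. If every `φᵢ` is `Δᵢ`-decomposable and every `ψᵢ` is `Δᵢ`-continuous,
then the free products `φ₁ * ⋯ * φₙ` and `ψ₁ * ⋯ * ψₙ` are quasimorphisms of `F₁ * ⋯ * Fₙ`, and the
cup product of their classes vanishes in `H⁴_b(F₁ * ⋯ * Fₙ)`. -/
theorem mainTheorem6 {n : ℕ} (S : Fin n → Type*) [∀ i, DecidableEq (S i)] [∀ i, Finite (S i)]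
    [∀ i, Nontrivial (S i)] (Δ : ∀ i, Decomposition (S i))
    (φ ψ : ∀ i, FreeGroup (S i) → ℝ)
    (hφ : ∀ i, IsDecomposable (Δ i) (φ i))
    (hψ : ∀ i, IsDeltaContinuous (Δ i) (ψ i)) :
    ∃ (hΦ : IsQuasimorphism (G := Monoid.CoprodI fun i => FreeGroup (S i)) (freeProductFun φ))
      (hΨ : IsQuasimorphism (G := Monoid.CoprodI fun i => FreeGroup (S i)) (freeProductFun ψ)),
      cupProduct (show 2 + 2 = 4 from rfl) (coboundaryClass (freeProductFun φ) hΦ)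
        (coboundaryClass (freeProductFun ψ) hΨ) = 0 := by
  obtain ⟨hΦ, h⟩ := cochainCup_freeProductFun_mem Δ hφ
  have hΨ := isQuasimorphism_freeProductFun (fun i => (hψ i).1) fun i => (hψ i).2.1
  exact ⟨hΦ, hΨ, (Submodule.Quotient.mk_eq_zero _).2 (h _ (barδ_toCochain_mem hΨ))⟩
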